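/- Let $N\in\{2,3\}$, let $\Omega\subset\mathbb{R}^N$ be a bounded convex polyhedral domain, let $T>0$, and set $\mathcal K(w)=\tfrac12\|w\|_{L^\infty(\Omega)}^2$. Let $d^m,\boldsymbol d,U^m,\boldsymbol U$ be functions on $(0,T)\times\Omega$ with values in $\mathbb{R}^3$ (if $N=2$, $\mathbb{R}^2$-valued fields are included by identifying $(x_1,x_2)$ with $(x_1,x_2,0)$), let $G^m$ have values in $\mathbb{R}^{3\times N}$, and let $\tilde v^m,\tilde{\boldsymbol v}$ have values in $\mathbb{R}^N$. Assume that $\boldsymbol d$ has a weak spatial gradient $\nabla\boldsymbol d$ (with $(\nabla \boldsymbol d)_{ij}=\partial_j\boldsymbol d_i$) and that, as $m\to\infty$, \begin{align*} d^m&\to\boldsymbol d &&\text{in } L^p(0,T;L^p(\Omega;\mathbb{R}^3)) \text{ for all } 1\le p<\infty,\\ G^m&\rightharpoonup\nabla\boldsymbol d &&\text{weakly in } L^2(0,T;L^2(\Omega;\mathbb{R}^{3\times N})),\\ U^m&\rightharpoonup\boldsymbol U &&\text{weakly in } L^2(0,T;L^2(\Omega;\mathbb{R}^3)),\\ \tilde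 v^m&\to\tilde{\boldsymbol v} &&\text{in } L^\infty(0,T;L^\infty(\Omega;\mathbb{R}^N)). \end{align*} Assume further that $\sup_m\|d^m\|_{L^\infty((0,T)\times\Omega)}\le 1$ and $\sup_m\|\tilde v^m\|_{L^\infty(0,T;H^2(\Omega))}\le C$ for some constant $C>0$. Then for every $\phi\in L^\infty(0,T)$ with $\phi\ge0$ the time integrands below are integrable on $(0,T)$, and \begin{multline*} \int_0^T\phi\Big[\|\boldsymbol U\|_{L^2(\Omega)}^2-\big((\nabla\boldsymbol d)^T(\boldsymbol d\times\boldsymbol U),\tilde{\boldsymbol v}\big)_{L^2(\Omega)}+\mathcal K(\tilde{\boldsymbol v})\,\tfrac12\|\nabla\boldsymbol d\|_{L^2(\Omega)}^2\Big]\,d\tau\\ \le\liminf_{m\to\infty}\int_0^T\phi\Big[\|U^m\|_{L^2(\Omega)}^2-\big((G^m)^T(d^m\times U^m),\tilde v^m\big)_{L^2(\Omega)}+\mathcal K(\tilde v^m)\,\tfrac12\|G^m\|_{L^2(\Omega)}^2\Big]\,d\tau . \end{multline*} In particular the same inequality holds along every subsequence. -/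

import Mathlib

open MeasureTheory Filter Topology
open scoped ENNReal Matrix ContDiff

noncomputable section

namespace EricksenStress

/-- `ℝⁿ` with the Euclidean norm. -/
abbrev Vec (n : ℕ) : Type := EuclideanSpace ℝ (Fin n)

/-- Real `3 × N` matrices, stored by their entries `A (i, j)`; the Euclidean norm of the entries is
the Frobenius norm `(A : A)^{1/2}`. -/
abbrev Mat3 (N : ℕ) : Type := EuclideanSpace ℝ (Fin 3 × Fin N)

/-- A bounded convex polyhedral domain: a nonempty, bounded, open, convex set whose closure is the
convex hull of finitely many points. -/
structure IsConvexPolyhedralDomain {N : ℕ} (Ω : Set (Vec N)) : Prop where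
  nonempty : Ω.Nonempty
  isOpen : IsOpen Ω
  isBounded : Bornology.IsBounded Ω
  convex : Convex ℝ Ω
  polyhedral : ∃ s : Set (Vec N), s.Finite ∧ closure Ω = convexHull ℝ s

/-- Lebesgue measure on the space-time cylinder `(0,T) × Ω`. By Fubini, `L^p(0,T;L^p(Ω))` is `L^p` of
this measure. -/
def cylinder {N : ℕ} (T : ℝ) (Ω : Set (Vec N)) : Measure (ℝ × Vec N) :=
  (volume.restrict (Set.Ioo 0 T)).prod (volume.restrict Ω)

/-- Strong convergence `f m → g` in `L^p(μ)`. -/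
def StrongLpTendsto {α V : Type*} [MeasurableSpace α] [NormedAddCommGroup V]
    (p : ℝ≥0∞) (μ : Measure α) (f : ℕ → α → V) (g : α → V) : Prop :=
  (∀ m, MemLp (f m) p μ) ∧ MemLp g p μ ∧
    Tendsto (fun m => eLpNorm (f m - g) p μ) atTop (𝓝 0)

/-- Weak convergence `f m ⇀ g` in `L²(μ)`: convergence of the classes in the weak topology of the
Banach space `L²(μ)`. -/
def WeakL2Tendsto {α V : Type*} [MeasurableSpace α] [NormedAddCommGroup V] [NormedSpace ℝ V]
    (μ : Measure α) (f : ℕ → α → V) (g : α → V) : Prop :=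
  ∃ (hf : ∀ m, MemLp (f m) 2 μ) (hg : MemLp g 2 μ),
    Tendsto (fun m => toWeakSpace ℝ (Lp V 2 μ) ((hf m).toLp (f m))) atTop
      (𝓝 (toWeakSpace ℝ (Lp V 2 μ) (hg.toLp g)))

/-- `g` is the weak partial derivative `∂_j f` on the open set `Ω`. -/
def HasWeakPartialDeriv {N : ℕ} {V : Type*} [NormedAddCommGroup V] [NormedSpace ℝ V]
    (Ω : Set (Vec N)) (j : Fin N) (f g : Vec N → V) : Prop :=
  LocallyIntegrableOn f Ω ∧ LocallyIntegrableOn g Ω ∧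
    ∀ ψ : Vec N → ℝ, ContDiff ℝ ∞ ψ → HasCompactSupport ψ → tsupport ψ ⊆ Ω →
      ∫ x in Ω, (fderiv ℝ ψ x (EuclideanSpace.single j 1)) • f x = - ∫ x in Ω, ψ x • g x

/-- `D` is the weak gradient `∇d` of the `ℝ³`-valued field `d` on `Ω`, with entries
`(∇d)_{ij} = ∂_j d_i`. -/
def HasWeakGradient {N : ℕ} (Ω : Set (Vec N)) (d : Vec N → Vec 3) (D : Vec N → Mat3 N) : Prop :=
  ∀ j : Fin N, HasWeakPartialDeriv Ω j d (fun x => WithLp.toLp 2 (fun i => D x (i, j)))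

/-- `v ∈ H²(Ω)` and `‖v‖_{H²(Ω)} ≤ C` (for `C ≥ 0`), where `‖v‖_{H²}²` is the sum of the squared
`L²` norms of `v` and of all its weak derivatives of order one and two. -/
def H2NormLE {N : ℕ} {V : Type*} [NormedAddCommGroup V] [NormedSpace ℝ V]
    (Ω : Set (Vec N)) (v : Vec N → V) (C : ℝ) : Prop :=
  ∃ (v₁ : Fin N → Vec N → V) (v₂ : Fin N → Fin N → Vec N → V),
    MemLp v 2 (volume.restrict Ω) ∧
    (∀ i, MemLp (v₁ i) 2 (volume.restrict Ω) ∧ HasWeakPartialDeriv Ω i v (v₁ i)) ∧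
    (∀ i j, MemLp (v₂ i j) 2 (volume.restrict Ω) ∧
      HasWeakPartialDeriv Ω j (v₁ i) (v₂ i j)) ∧
    eLpNorm v 2 (volume.restrict Ω) ^ 2
      + ∑ i, eLpNorm (v₁ i) 2 (volume.restrict Ω) ^ 2
      + ∑ i, ∑ j, eLpNorm (v₂ i j) 2 (volume.restrict Ω) ^ 2 ≤ ENNReal.ofReal C ^ 2

/-- The regularity weight `𝒦(v) = ½ ‖v‖²_{L^∞(Ω)}`. -/
def regWeight {N : ℕ} (Ω : Set (Vec N)) (v : Vec N → Vec N) : ℝ :=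
  1 / 2 * (eLpNorm v ∞ (volume.restrict Ω)).toReal ^ 2

/-- The vector `Aᵀ (d × u) ∈ ℝᴺ`, for a `3 × N` matrix `A` and `d, u ∈ ℝ³`. -/
def transposeMulCross {N : ℕ} (A : Mat3 N) (d u : Vec 3) : Fin N → ℝ :=
  (Matrix.of fun i j => A (i, j))ᵀ *ᵥ (d.ofLp ⨯₃ u.ofLp)

/-- The functional
`‖U‖²_{L²(Ω)} - (Gᵀ (d × U), v)_{L²(Ω)} + 𝒦(v) ½ ‖G‖²_{L²(Ω)}` of fields on `Ω`. -/
def stressFunctional {N : ℕ} (Ω : Set (Vec N)) (d U : Vec N → Vec 3) (G : Vec N → Mat3 N)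
    (v : Vec N → Vec N) : ℝ :=
  (∫ x in Ω, ‖U x‖ ^ 2)
    - (∫ x in Ω, transposeMulCross (G x) (d x) (U x) ⬝ᵥ (v x).ofLp)
    + regWeight Ω v * (1 / 2 * ∫ x in Ω, ‖G x‖ ^ 2)

/-- The functional `stressFunctional` at time `t`, weighted by `φ(t)`, for fields on the space-time
cylinder. -/
def stressDensity {N : ℕ} (Ω : Set (Vec N)) (φ : ℝ → ℝ) (d U : ℝ × Vec N → Vec 3)
    (G : ℝ × Vec N → Mat3 N) (v : ℝ × Vec N → Vec N) (t : ℝ) : ℝ :=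
  φ t * stressFunctional Ω (fun x => d (t, x)) (fun x => U (t, x)) (fun x => G (t, x))
    (fun x => v (t, x))

end EricksenStress

end

/-
For fixed `d` and `v` the density is a quadratic form in `(U, G)`. Since
`(Gᵀ (d × U)) · v ≤ |v| |G| |U|` when `|d| ≤ 1`, and `|v|² ≤ 2 𝒦(v)`, completing the square shows
that this form is nonnegative. It therefore lies above its tangent planes. In the tangent plane at
the limit `(U, ∇d)`, the slope is `S^m (U, ∇d)` with uniformly bounded coefficients `S^m` that
converge in measure. Dominated convergence gives its strong convergence in `L²`, so the tangent
planes pass to the limit against the weak convergence of `(U^m, G^m)`.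
-/

noncomputable section

namespace EricksenStress

section WeakConvergence

variable {α V W : Type*} [MeasurableSpace α] {μ : Measure α}

lemma exists_norm_le_of_tendsto_inner {E : Type*} [NormedAddCommGroup E] [InnerProductSpace ℝ E]
    [CompleteSpace E] {x : ℕ → E} {x₀ : E}
    (hx : ∀ y : E, Tendsto (fun m => inner ℝ y (x m)) atTop (𝓝 (inner ℝ y x₀))) :
    ∃ K, ∀ m, ‖x m‖ ≤ K := by
  obtain ⟨K, hK⟩ : ∃ K, ∀ m, ‖innerSL ℝ (x m)‖ ≤ K := by
    refine banach_steinhaus fun y => ?_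
    obtain ⟨b, hb⟩ := (hx y).norm.bddAbove_range
    refine ⟨b, fun m => ?_⟩
    rw [innerSL_apply_apply, real_inner_comm]
    exact hb ⟨m, rfl⟩
  exact ⟨K, fun m => (innerSL_apply_norm (𝕜 := ℝ) (x m)).symm.trans_le (hK m)⟩

lemma tendsto_inner_of_tendsto_toWeakSpace {E : Type*} [NormedAddCommGroup E]
    [InnerProductSpace ℝ E] [CompleteSpace E] {x y : ℕ → E} {x₀ y₀ : E}
    (hx : Tendsto (fun m => toWeakSpace ℝ E (x m)) atTop (𝓝 (toWeakSpace ℝ E x₀)))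
    (hy : Tendsto y atTop (𝓝 y₀)) :
    Tendsto (fun m => inner ℝ (y m) (x m)) atTop (𝓝 (inner ℝ y₀ x₀)) := by
  have eval (z : E) : Tendsto (fun m => inner ℝ z (x m)) atTop (𝓝 (inner ℝ z x₀)) :=
    ((WeakBilin.eval_continuous (topDualPairing ℝ E).flip (innerSL ℝ z)).tendsto _).comp hx
  obtain ⟨K, hK⟩ := exists_norm_le_of_tendsto_inner eval
  have error : Tendsto (fun m => inner ℝ (y m - y₀) (x m)) atTop (𝓝 0) := by
    refine squeeze_zero_norm (a := fun m => ‖y m - y₀‖ * K)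
      (fun m => (norm_inner_le_norm _ _).trans (by gcongr; exact hK m)) ?_
    simpa only [zero_mul] using (tendsto_iff_norm_sub_tendsto_zero.1 hy).mul_const K
  simpa only [inner_sub_left, sub_add_cancel, zero_add] using error.add (eval y₀)

section Inner

variable [NormedAddCommGroup V] [InnerProductSpace ℝ V]

lemma integrable_inner_of_memLp {f g : α → V} (hf : MemLp f 2 μ) (hg : MemLp g 2 μ) :
    Integrable (fun x => inner ℝ (f x) (g x)) μ :=
  memLp_one_iff_integrable.1 ((innerSL ℝ).memLp_of_bilin 1 hf hg)

lemma integral_inner_eq_inner_toLp {f g : α → V} (hf : MemLp f 2 μ) (hg : MemLp g 2 μ) :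
    ∫ x, inner ℝ (f x) (g x) ∂μ = inner ℝ (hf.toLp f) (hg.toLp g) := by
  rw [L2.inner_def]
  refine integral_congr_ae ?_
  filter_upwards [hf.coeFn_toLp, hg.coeFn_toLp] with x hfx hgx
  rw [hfx, hgx]

lemma WeakL2Tendsto.tendsto_integral_inner [CompleteSpace V] {f h : ℕ → α → V} {f₀ h₀ : α → V}
    (hf : WeakL2Tendsto μ f f₀) (hh : StrongLpTendsto 2 μ h h₀) :
    Tendsto (fun m => ∫ x, inner ℝ (h m x) (f m x) ∂μ) atTop
      (𝓝 (∫ x, inner ℝ (h₀ x) (f₀ x) ∂μ)) := by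
  obtain ⟨hf, hf₀, hweak⟩ := hf
  obtain ⟨hh, hh₀, hstrong⟩ := hh
  simp_rw [fun m => integral_inner_eq_inner_toLp (hh m) (hf m),
    integral_inner_eq_inner_toLp hh₀ hf₀]
  exact tendsto_inner_of_tendsto_toWeakSpace hweak
    ((Lp.tendsto_Lp_iff_tendsto_eLpNorm'' h hh h₀ hh₀).2 hstrong)

end Inner

variable [NormedAddCommGroup V] [NormedSpace ℝ V] [NormedAddCommGroup W] [NormedSpace ℝ W]

lemma weakL2Tendsto_const {f : α → V} (hf : MemLp f 2 μ) : WeakL2Tendsto μ (fun _ => f) f :=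
  ⟨fun _ => hf, hf, tendsto_const_nhds⟩

lemma WeakL2Tendsto.add {f g : ℕ → α → V} {f₀ g₀ : α → V} (hf : WeakL2Tendsto μ f f₀)
    (hg : WeakL2Tendsto μ g g₀) : WeakL2Tendsto μ (f + g) (f₀ + g₀) := by
  obtain ⟨hf, hf₀, hflim⟩ := hf
  obtain ⟨hg, hg₀, hglim⟩ := hg
  exact ⟨fun m => (hf m).add (hg m), hf₀.add hg₀, hflim.add hglim⟩

lemma WeakL2Tendsto.clm_comp {f : ℕ → α → V} {f₀ : α → V} (hf : WeakL2Tendsto μ f f₀)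
    (L : V →L[ℝ] W) : WeakL2Tendsto μ (fun m => L ∘ f m) (L ∘ f₀) := by
  obtain ⟨hf, hf₀, hlim⟩ := hf
  have toLp_comp {g : α → V} (hg : MemLp g 2 μ) :
      (L.comp_memLp' hg).toLp (L ∘ g) = L.compLpL 2 μ (hg.toLp g) := by
    refine Lp.ext ?_
    filter_upwards [(L.comp_memLp' hg).coeFn_toLp, L.coeFn_compLpL (hg.toLp g),
      hg.coeFn_toLp] with x h₁ h₂ h₃
    rw [h₁, h₂, h₃, Function.comp_apply]
  refine ⟨fun m => L.comp_memLp' (hf m), L.comp_memLp' hf₀, ?_⟩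
  rw [toLp_comp hf₀]
  refine (((WeakSpace.map (L.compLpL 2 μ)).continuous.tendsto _).comp hlim).congr fun m => ?_
  exact congrArg (toWeakSpace ℝ (Lp W 2 μ)) (toLp_comp (hf m)).symm

lemma WeakL2Tendsto.prodMk {f : ℕ → α → V} {f₀ : α → V} {g : ℕ → α → W} {g₀ : α → W}
    (hf : WeakL2Tendsto μ f f₀) (hg : WeakL2Tendsto μ g g₀) :
    WeakL2Tendsto μ (fun m x => WithLp.toLp 2 (f m x, g m x))
      (fun x => WithLp.toLp 2 (f₀ x, g₀ x)) := by
  let ι : V × W →L[ℝ] WithLp 2 (V × W) := (WithLp.prodContinuousLinearEquiv 2 ℝ V W).symm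
  convert (hf.clm_comp (ι ∘L .inl ℝ V W)).add (hg.clm_comp (ι ∘L .inr ℝ V W)) using 1 <;>
    ext <;> simp [ι, ← WithLp.toLp_add]

end WeakConvergence

section DominatedConvergence

variable {α V X Y : Type*} [MeasurableSpace α] {μ : Measure α}

/-- Every subsequence of `f` has a further subsequence converging to `f₀` almost everywhere. On a
finite measure space this is convergence in measure; unlike the latter it is stable under continuous
maps on every measure space. -/
def TendstoAESubseq [TopologicalSpace X] (μ : Measure α) (f : ℕ → α → X) (f₀ : α → X) : Prop :=
  ∀ ns : ℕ → ℕ, Tendsto ns atTop atTop → ∃ ms : ℕ → ℕ, Tendsto ms atTop atTop ∧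
    ∀ᵐ x ∂μ, Tendsto (fun k => f (ns (ms k)) x) atTop (𝓝 (f₀ x))

lemma tendstoAESubseq_of_ae_tendsto [TopologicalSpace X] {f : ℕ → α → X} {f₀ : α → X}
    (hf : ∀ᵐ x ∂μ, Tendsto (fun m => f m x) atTop (𝓝 (f₀ x))) : TendstoAESubseq μ f f₀ :=
  fun _ hns => ⟨id, tendsto_id, hf.mono fun _ hx => hx.comp hns⟩

lemma tendstoAESubseq_of_tendstoInMeasure [PseudoEMetricSpace X] {f : ℕ → α → X} {f₀ : α → X}
    (hf : TendstoInMeasure μ f atTop f₀) : TendstoAESubseq μ f f₀ := fun _ hns =>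
  have ⟨ms, hms, hlim⟩ := (hf.comp hns).exists_seq_tendsto_ae
  ⟨ms, hms.tendsto_atTop, hlim⟩

lemma StrongLpTendsto.tendstoAESubseq [NormedAddCommGroup V] {p : ℝ≥0∞} (hp : p ≠ 0)
    {f : ℕ → α → V} {f₀ : α → V} (hf : StrongLpTendsto p μ f f₀) : TendstoAESubseq μ f f₀ :=
  tendstoAESubseq_of_tendstoInMeasure
    (tendstoInMeasure_of_tendsto_eLpNorm hp (fun m => (hf.1 m).1) hf.2.1.1 hf.2.2)

namespace TendstoAESubseq

lemma exists_seq_tendsto_ae [TopologicalSpace X] {f : ℕ → α → X} {f₀ : α → X}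
    (hf : TendstoAESubseq μ f f₀) :
    ∃ ns : ℕ → ℕ, ∀ᵐ x ∂μ, Tendsto (fun k => f (ns k) x) atTop (𝓝 (f₀ x)) :=
  have ⟨ms, _, hlim⟩ := hf id tendsto_id
  ⟨ms, hlim⟩

lemma prodMk [TopologicalSpace X] [TopologicalSpace Y] {f : ℕ → α → X} {f₀ : α → X}
    {g : ℕ → α → Y} {g₀ : α → Y} (hf : TendstoAESubseq μ f f₀) (hg : TendstoAESubseq μ g g₀) :
    TendstoAESubseq μ (fun m x => (f m x, g m x)) (fun x => (f₀ x, g₀ x)) := by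
  intro ns hns
  obtain ⟨ms, hms, hflim⟩ := hf ns hns
  obtain ⟨ks, hks, hglim⟩ := hg (ns ∘ ms) (hns.comp hms)
  refine ⟨ms ∘ ks, hms.comp hks, ?_⟩
  filter_upwards [hflim, hglim] with x hfx hgx using (hfx.comp hks).prodMk_nhds hgx

lemma continuous_comp [TopologicalSpace X] [TopologicalSpace Y] {f : ℕ → α → X} {f₀ : α → X}
    (hf : TendstoAESubseq μ f f₀) {F : α → X → Y} (hF : ∀ x, Continuous (F x)) :
    TendstoAESubseq μ (fun m x => F x (f m x)) (fun x => F x (f₀ x)) := fun ns hns =>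
  have ⟨ms, hms, hlim⟩ := hf ns hns
  ⟨ms, hms, hlim.mono fun x hx => ((hF x).tendsto _).comp hx⟩

lemma aestronglyMeasurable [TopologicalSpace X] [TopologicalSpace.PseudoMetrizableSpace X]
    {f : ℕ → α → X} {f₀ : α → X} (hf : TendstoAESubseq μ f f₀)
    (hmeas : ∀ m, AEStronglyMeasurable (f m) μ) : AEStronglyMeasurable f₀ μ :=
  have ⟨ns, hlim⟩ := hf.exists_seq_tendsto_ae
  aestronglyMeasurable_of_tendsto_ae atTop (fun k => hmeas (ns k)) hlim

variable [NormedAddCommGroup V] {f : ℕ → α → V} {f₀ : α → V}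

lemma ae_norm_le (hf : TendstoAESubseq μ f f₀) {g : α → ℝ} (hb : ∀ m, ∀ᵐ x ∂μ, ‖f m x‖ ≤ g x) :
    ∀ᵐ x ∂μ, ‖f₀ x‖ ≤ g x := by
  obtain ⟨ns, hlim⟩ := hf.exists_seq_tendsto_ae
  filter_upwards [hlim, ae_all_iff.2 hb] with x hx hbx
  exact le_of_tendsto' hx.norm fun k => hbx (ns k)

end TendstoAESubseq

variable [NormedAddCommGroup V] {f : ℕ → α → V} {f₀ : α → V} {p : ℝ≥0∞} {g : α → ℝ}

lemma tendsto_eLpNorm_sub_of_dominated (hp₀ : p ≠ 0) (hp : p ≠ ⊤)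
    (hf : ∀ m, AEStronglyMeasurable (f m) μ) (hg : MemLp g p μ)
    (hb : ∀ m, ∀ᵐ x ∂μ, ‖f m x‖ ≤ g x)
    (hlim : ∀ᵐ x ∂μ, Tendsto (fun m => f m x) atTop (𝓝 (f₀ x))) :
    Tendsto (fun m => eLpNorm (f m - f₀) p μ) atTop (𝓝 0) := by
  have hpos : 0 < p.toReal := ENNReal.toReal_pos hp₀ hp
  have hf₀ : AEStronglyMeasurable f₀ μ := aestronglyMeasurable_of_tendsto_ae atTop hf hlim
  have hb₀ : ∀ᵐ x ∂μ, ‖f₀ x‖ ≤ g x := (tendstoAESubseq_of_ae_tendsto hlim).ae_norm_le hb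
  have lintegral_tendsto : Tendsto (fun m => ∫⁻ x, ‖(f m - f₀) x‖ₑ ^ p.toReal ∂μ) atTop
      (𝓝 (∫⁻ _, 0 ∂μ)) := by
    refine tendsto_lintegral_of_dominated_convergence' (fun x => ‖2 * g x‖ₑ ^ p.toReal)
      (fun m => ((hf m).sub hf₀).enorm.pow_const _) (fun m => ?_)
      (lintegral_rpow_enorm_lt_top_of_eLpNorm_lt_top hp₀ hp
        (hg.const_mul 2).eLpNorm_lt_top).ne ?_
    · filter_upwards [hb m, hb₀] with x hx hx₀
      gcongr
      rw [enorm_le_iff_norm_le, Pi.sub_apply]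
      exact (norm_sub_le _ _).trans ((add_le_add hx hx₀).trans (by
        rw [← two_mul]; exact le_abs_self _))
    · filter_upwards [hlim] with x hx
      have := ((hx.sub_const (f₀ x)).enorm).ennrpow_const p.toReal
      simpa [hpos] using this
  simp_rw [eLpNorm_eq_lintegral_rpow_enorm_toReal hp₀ hp]
  simpa [hpos] using lintegral_tendsto.ennrpow_const (1 / p.toReal)

lemma TendstoAESubseq.strongLpTendsto (hlim : TendstoAESubseq μ f f₀) (hp₀ : p ≠ 0) (hp : p ≠ ⊤)
    (hf : ∀ m, AEStronglyMeasurable (f m) μ) (hg : MemLp g p μ)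
    (hb : ∀ m, ∀ᵐ x ∂μ, ‖f m x‖ ≤ g x) : StrongLpTendsto p μ f f₀ := by
  refine ⟨fun m => hg.mono' (hf m) (hb m),
    hg.mono' (hlim.aestronglyMeasurable hf) (hlim.ae_norm_le hb),
    tendsto_of_subseq_tendsto fun ns hns => ?_⟩
  obtain ⟨ms, -, hms⟩ := hlim ns hns
  exact ⟨ms, tendsto_eLpNorm_sub_of_dominated hp₀ hp (fun k => hf _) hg (fun k => hb _) hms⟩

end DominatedConvergence

section LowerSemicontinuity

variable {α V W : Type*} [MeasurableSpace α] {μ : Measure α} [NormedAddCommGroup V]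
  [NormedSpace ℝ V] [NormedAddCommGroup W] [InnerProductSpace ℝ W]

lemma two_mul_inner_sub_inner_le_of_isPositive {S : W →L[ℝ] W} (hS : S.IsPositive) (x y : W) :
    2 * inner ℝ (S x) y - inner ℝ (S x) x ≤ inner ℝ (S y) y := by
  have hnonneg := hS.inner_nonneg_left (y - x)
  have hsymm : inner ℝ (S y) x = inner ℝ (S x) y := by
    rw [hS.inner_left_eq_inner_right, real_inner_comm]
  simp only [map_sub, inner_sub_left, inner_sub_right] at hnonneg
  linarith

lemma memLp_two_clm_apply {S : α → V →L[ℝ] W} {w : α → V} (hS : MemLp S ∞ μ) (hw : MemLp w 2 μ) :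
    MemLp (fun x => S x (w x)) 2 μ :=
  (ContinuousLinearMap.id ℝ (V →L[ℝ] W)).memLp_of_bilin 2 hS hw

lemma integrable_inner_clm_apply {S : α → V →L[ℝ] W} {w : α → V} {u : α → W} (hS : MemLp S ∞ μ)
    (hw : MemLp w 2 μ) (hu : MemLp u 2 μ) : Integrable (fun x => inner ℝ (S x (w x)) (u x)) μ :=
  integrable_inner_of_memLp (memLp_two_clm_apply hS hw) hu

lemma strongLpTendsto_clm_apply {Sm : ℕ → α → V →L[ℝ] W} {S : α → V →L[ℝ] W} {w : α → V} {B : ℝ}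
    (hSm : ∀ m, AEStronglyMeasurable (Sm m) μ) (hB : ∀ m, ∀ᵐ x ∂μ, ‖Sm m x‖ ≤ B)
    (hS : TendstoAESubseq μ Sm S) (hw : MemLp w 2 μ) :
    StrongLpTendsto 2 μ (fun m x => Sm m x (w x)) (fun x => S x (w x)) := by
  have hlim := hS.continuous_comp (F := fun x T => T (w x)) fun x => by fun_prop
  refine hlim.strongLpTendsto two_ne_zero ENNReal.ofNat_ne_top
    (fun m => (memLp_two_clm_apply (memLp_top_of_bound (hSm m) B (hB m)) hw).1)
    (hw.norm.const_mul B) fun m => ?_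
  filter_upwards [hB m] with x hx using (Sm m x).le_of_opNorm_le hx (w x)

theorem integral_inner_le_liminf_of_isPositive [CompleteSpace W] {Sm : ℕ → α → W →L[ℝ] W}
    {S : α → W →L[ℝ] W} {wm : ℕ → α → W} {w : α → W} {B : ℝ}
    (hSm : ∀ m, AEStronglyMeasurable (Sm m) μ) (hB : ∀ m, ∀ᵐ x ∂μ, ‖Sm m x‖ ≤ B)
    (hpos : ∀ m, ∀ᵐ x ∂μ, (Sm m x).IsPositive) (hS : TendstoAESubseq μ Sm S)
    (hw : WeakL2Tendsto μ wm w) :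
    ((∫ x, inner ℝ (S x (w x)) (w x) ∂μ : ℝ) : EReal) ≤
      liminf (fun m => ((∫ x, inner ℝ (Sm m x (wm m x)) (wm m x) ∂μ : ℝ) : EReal)) atTop := by
  obtain ⟨hwm₂, hw₂, -⟩ := id hw
  have hstrong := strongLpTendsto_clm_apply hSm hB hS hw₂
  have tangent_tendsto :
      Tendsto (fun m => 2 * (∫ x, inner ℝ (Sm m x (w x)) (wm m x) ∂μ)
          - ∫ x, inner ℝ (Sm m x (w x)) (w x) ∂μ) atTop
        (𝓝 (∫ x, inner ℝ (S x (w x)) (w x) ∂μ)) := by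
    convert ((hw.tendsto_integral_inner hstrong).const_mul 2).sub
      ((weakL2Tendsto_const hw₂).tendsto_integral_inner hstrong) using 2
    ring
  have tangent_le (m : ℕ) : 2 * (∫ x, inner ℝ (Sm m x (w x)) (wm m x) ∂μ)
      - ∫ x, inner ℝ (Sm m x (w x)) (w x) ∂μ ≤ ∫ x, inner ℝ (Sm m x (wm m x)) (wm m x) ∂μ := by
    have hcross := (integrable_inner_of_memLp (hstrong.1 m) (hwm₂ m)).const_mul 2
    have hconst := integrable_inner_of_memLp (hstrong.1 m) hw₂
    rw [← integral_const_mul, ← integral_sub hcross hconst]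
    refine integral_mono_ae (hcross.sub hconst) (integrable_inner_clm_apply
      (memLp_top_of_bound (hSm m) B (hB m)) (hwm₂ m) (hwm₂ m)) ?_
    filter_upwards [hpos m] with x hx using two_mul_inner_sub_inner_le_of_isPositive hx _ _
  rw [← (EReal.tendsto_coe.2 tangent_tendsto).liminf_eq]
  exact liminf_le_liminf (Eventually.of_forall fun m => EReal.coe_le_coe (tangent_le m))

theorem integral_mul_inner_le_liminf_of_isPositive [CompleteSpace W] {c : α → ℝ}
    {Sm : ℕ → α → W →L[ℝ] W} {S : α → W →L[ℝ] W} {wm : ℕ → α → W} {w : α → W} {B : ℝ}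
    (hc : MemLp c ∞ μ) (hc₀ : ∀ᵐ x ∂μ, 0 ≤ c x)
    (hSm : ∀ m, AEStronglyMeasurable (Sm m) μ) (hB : ∀ m, ∀ᵐ x ∂μ, ‖Sm m x‖ ≤ B)
    (hpos : ∀ m, ∀ᵐ x ∂μ, (Sm m x).IsPositive) (hS : TendstoAESubseq μ Sm S)
    (hw : WeakL2Tendsto μ wm w) :
    ((∫ x, c x * inner ℝ (S x (w x)) (w x) ∂μ : ℝ) : EReal) ≤
      liminf (fun m => ((∫ x, c x * inner ℝ (Sm m x (wm m x)) (wm m x) ∂μ : ℝ) : EReal))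
        atTop := by
  have hlim := hS.continuous_comp (F := fun x T => c x • T) fun x => continuous_const_smul (c x)
  have h := integral_inner_le_liminf_of_isPositive (B := lpNorm c ∞ μ * B)
    (fun m => hc.1.smul (hSm m)) (fun m => ?_) (fun m => ?_) hlim hw
  · simpa only [Pi.smul_apply', smul_apply, real_inner_smul_left] using h
  · filter_upwards [ae_le_lpNorm_exponent_top hc, hB m] with x hcx hx
    simpa only [Pi.smul_apply', norm_smul] using
      mul_le_mul hcx hx (norm_nonneg _) ((norm_nonneg _).trans hcx)
  · filter_upwards [hc₀, hpos m] with x hcx hx using hx.smul_of_nonneg hcx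

end LowerSemicontinuity

section BlockOperator

variable {E F W : Type*} [NormedAddCommGroup E] [InnerProductSpace ℝ E] [NormedAddCommGroup F]

section CoupledForm

variable [NormedSpace ℝ F]

/-- The quadratic form `(u, a) ↦ ‖u‖² - ⟪K a, u⟫ + κ ½ ‖a‖²`. -/
def coupledForm (κ : ℝ) (K : F →L[ℝ] E) (u : E) (a : F) : ℝ :=
  ‖u‖ ^ 2 - inner ℝ (K a) u + κ * (1 / 2 * ‖a‖ ^ 2)

lemma coupledForm_nonneg {κ : ℝ} {K : F →L[ℝ] E} (hK : ‖K‖ ^ 2 ≤ 2 * κ) (u : E) (a : F) :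
    0 ≤ coupledForm κ K u a := by
  have coupling_le : inner ℝ (K a) u ≤ ‖K‖ * ‖a‖ * ‖u‖ :=
    (real_inner_le_norm _ _).trans (by gcongr; exact K.le_opNorm _)
  calc 0 ≤ (‖u‖ - ‖K‖ * ‖a‖ / 2) ^ 2 + (2 * κ - ‖K‖ ^ 2) * ‖a‖ ^ 2 / 4 := by
        have := sub_nonneg.2 hK
        positivity
    _ = ‖u‖ ^ 2 - ‖K‖ * ‖a‖ * ‖u‖ + κ * (1 / 2 * ‖a‖ ^ 2) := by ring
    _ ≤ coupledForm κ K u a := by unfold coupledForm; gcongr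

lemma integrable_coupledForm {α : Type*} [MeasurableSpace α] {μ : Measure α} {κ : α → ℝ}
    {K : α → F →L[ℝ] E} {u : α → E} {a : α → F} (hκ : MemLp κ ∞ μ) (hK : MemLp K ∞ μ)
    (hu : MemLp u 2 μ) (ha : MemLp a 2 μ) :
    Integrable (fun x => coupledForm (κ x) (K x) (u x) (a x)) μ :=
  ((hu.integrable_norm_pow two_ne_zero).sub (integrable_inner_clm_apply hK ha hu)).add
    (((ha.integrable_norm_pow two_ne_zero).const_mul (1 / 2)).mul_of_top_right hκ)

end CoupledForm

variable [InnerProductSpace ℝ F] [CompleteSpace E] [CompleteSpace F] [NormedAddCommGroup W]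
  [InnerProductSpace ℝ W] [CompleteSpace W]

/-- The self-adjoint operator on `W` which represents the quadratic form `coupledForm κ K` pulled
back along `P` and `Q`. If these are the coordinate projections of `E × F`, it is
`[[1, -K/2], [-K†/2, κ/2]]`. -/
def blockOperator (P : W →L[ℝ] E) (Q : W →L[ℝ] F) (κ : ℝ) (K : F →L[ℝ] E) : W →L[ℝ] W :=
  let M := P.adjoint ∘L K ∘L Q
  P.adjoint ∘L P - (1 / 2 : ℝ) • (M + M.adjoint) + (κ / 2) • (Q.adjoint ∘L Q)

variable {P : W →L[ℝ] E} {Q : W →L[ℝ] F}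

lemma inner_blockOperator_self (κ : ℝ) (K : F →L[ℝ] E) (w : W) :
    inner ℝ (blockOperator P Q κ K w) w = coupledForm κ K (P w) (Q w) := by
  simp only [blockOperator, coupledForm, add_apply, sub_apply, smul_apply,
    ContinuousLinearMap.comp_apply, inner_add_left, inner_sub_left, real_inner_smul_left,
    ContinuousLinearMap.adjoint_inner_left, real_inner_self_eq_norm_sq]
  rw [real_inner_comm _ w, ContinuousLinearMap.adjoint_inner_left]
  ring

lemma isSelfAdjoint_blockOperator (κ : ℝ) (K : F →L[ℝ] E) :
    IsSelfAdjoint (blockOperator P Q κ K) := by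
  rw [ContinuousLinearMap.isSelfAdjoint_iff']
  simp only [blockOperator, map_add, map_sub, map_smulₛₗ, ContinuousLinearMap.adjoint_comp,
    ContinuousLinearMap.adjoint_adjoint, conj_trivial]
  rw [add_comm (ContinuousLinearMap.comp _ _)]

lemma isPositive_blockOperator {κ : ℝ} {K : F →L[ℝ] E} (hK : ‖K‖ ^ 2 ≤ 2 * κ) :
    (blockOperator P Q κ K).IsPositive :=
  ContinuousLinearMap.isPositive_def'.2 ⟨isSelfAdjoint_blockOperator κ K, fun w =>
    (coupledForm_nonneg hK (P w) (Q w)).trans_eq (inner_blockOperator_self κ K w).symm⟩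

lemma continuous_blockOperator :
    Continuous fun p : ℝ × (F →L[ℝ] E) => blockOperator P Q p.1 p.2 := by
  have hM : Continuous fun K : F →L[ℝ] E => P.adjoint ∘L K ∘L Q := by fun_prop
  have hM' := ContinuousLinearMap.adjoint.continuous.comp hM
  exact (continuous_const.sub (((hM.add hM').comp continuous_snd).const_smul (1 / 2 : ℝ))).add
    ((continuous_fst.div_const 2).smul continuous_const)

lemma opNorm_comp_le_of_le {X Y Z : Type*} [SeminormedAddCommGroup X] [NormedSpace ℝ X]
    [SeminormedAddCommGroup Y] [NormedSpace ℝ Y] [SeminormedAddCommGroup Z] [NormedSpace ℝ Z]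
    {g : Y →L[ℝ] Z} {f : X →L[ℝ] Y} {a b : ℝ} (hg : ‖g‖ ≤ a) (hf : ‖f‖ ≤ b) :
    ‖g ∘L f‖ ≤ a * b :=
  (g.opNorm_comp_le f).trans (mul_le_mul hg hf (norm_nonneg f) ((norm_nonneg g).trans hg))

lemma norm_blockOperator_le (hP : ‖P‖ ≤ 1) (hQ : ‖Q‖ ≤ 1) (κ : ℝ) (K : F →L[ℝ] E) :
    ‖blockOperator P Q κ K‖ ≤ 1 + ‖K‖ + |κ| / 2 := by
  let M := P.adjoint ∘L K ∘L Q
  have hP' : ‖P.adjoint‖ ≤ 1 := (LinearIsometryEquiv.norm_map _ P).trans_le hP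
  have hQ' : ‖Q.adjoint‖ ≤ 1 := (LinearIsometryEquiv.norm_map _ Q).trans_le hQ
  have hM : ‖M‖ ≤ 1 * (‖K‖ * 1) := opNorm_comp_le_of_le hP' (opNorm_comp_le_of_le le_rfl hQ)
  have hM' : ‖M.adjoint‖ ≤ 1 * (‖K‖ * 1) := (LinearIsometryEquiv.norm_map _ M).trans_le hM
  calc ‖blockOperator P Q κ K‖
      ≤ 1 * 1 + 1 / 2 * (1 * (‖K‖ * 1) + 1 * (‖K‖ * 1)) + |κ| / 2 * (1 * 1) := by
        refine norm_add_le_of_le (norm_sub_le_of_le (opNorm_comp_le_of_le hP' hP) ?_) ?_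
        · rw [norm_smul, Real.norm_of_nonneg (by norm_num)]
          gcongr
          exact norm_add_le_of_le hM hM'
        · rw [norm_smul, norm_div, Real.norm_ofNat, Real.norm_eq_abs]
          gcongr
          exact opNorm_comp_le_of_le hQ' hQ
    _ = 1 + ‖K‖ + |κ| / 2 := by ring

lemma norm_blockOperator_le_of_sq_le (hP : ‖P‖ ≤ 1) (hQ : ‖Q‖ ≤ 1) {κ : ℝ} {K : F →L[ℝ] E}
    (hK : ‖K‖ ^ 2 ≤ 2 * κ) : ‖blockOperator P Q κ K‖ ≤ 3 / 2 * (1 + κ) := by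
  have hκ : 0 ≤ κ := by linarith [sq_nonneg ‖K‖]
  refine (norm_blockOperator_le hP hQ κ K).trans ?_
  rw [abs_of_nonneg hκ]
  nlinarith [sq_nonneg (‖K‖ - 1)]

variable {α : Type*} [MeasurableSpace α] {μ : Measure α} {c : α → ℝ} {κm : ℕ → α → ℝ} {κ : α → ℝ}
  {Km : ℕ → α → F →L[ℝ] E} {K : α → F →L[ℝ] E} {B : ℝ}

lemma integral_coupledForm_comp_le_liminf (hP : ‖P‖ ≤ 1) (hQ : ‖Q‖ ≤ 1) {wm : ℕ → α → W}
    {w : α → W} (hc : MemLp c ∞ μ) (hc₀ : ∀ᵐ x ∂μ, 0 ≤ c x)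
    (hκm : ∀ m, AEStronglyMeasurable (κm m) μ) (hKm : ∀ m, AEStronglyMeasurable (Km m) μ)
    (hκB : ∀ m, ∀ᵐ x ∂μ, κm m x ≤ B) (hKκ : ∀ m, ∀ᵐ x ∂μ, ‖Km m x‖ ^ 2 ≤ 2 * κm m x)
    (hκ : TendstoAESubseq μ κm κ) (hK : TendstoAESubseq μ Km K) (hw : WeakL2Tendsto μ wm w) :
    ((∫ x, c x * coupledForm (κ x) (K x) (P (w x)) (Q (w x)) ∂μ : ℝ) : EReal) ≤
      liminf (fun m => ((∫ x, c x * coupledForm (κm m x) (Km m x) (P (wm m x)) (Q (wm m x)) ∂μ :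
        ℝ) : EReal)) atTop := by
  have hcont := continuous_blockOperator (P := P) (Q := Q)
  have hmeas (m : ℕ) := hcont.comp_aestronglyMeasurable ((hκm m).prodMk (hKm m))
  have hlim := (hκ.prodMk hK).continuous_comp fun _ => hcont
  have h := integral_mul_inner_le_liminf_of_isPositive (B := 3 / 2 * (1 + B)) hc hc₀
    hmeas (fun m => ?_) (fun m => (hKκ m).mono fun x => isPositive_blockOperator) hlim hw
  · simpa only [inner_blockOperator_self] using h
  · filter_upwards [hκB m, hKκ m] with x hκx hKx
    exact (norm_blockOperator_le_of_sq_le hP hQ hKx).trans (by gcongr)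

theorem integral_coupledForm_le_liminf {um : ℕ → α → E} {u : α → E} {am : ℕ → α → F} {a : α → F}
    (hc : MemLp c ∞ μ) (hc₀ : ∀ᵐ x ∂μ, 0 ≤ c x)
    (hκm : ∀ m, AEStronglyMeasurable (κm m) μ) (hKm : ∀ m, AEStronglyMeasurable (Km m) μ)
    (hκB : ∀ m, ∀ᵐ x ∂μ, κm m x ≤ B) (hKκ : ∀ m, ∀ᵐ x ∂μ, ‖Km m x‖ ^ 2 ≤ 2 * κm m x)
    (hκ : TendstoAESubseq μ κm κ) (hK : TendstoAESubseq μ Km K)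
    (hu : WeakL2Tendsto μ um u) (ha : WeakL2Tendsto μ am a) :
    ((∫ x, c x * coupledForm (κ x) (K x) (u x) (a x) ∂μ : ℝ) : EReal) ≤
      liminf (fun m => ((∫ x, c x * coupledForm (κm m x) (Km m x) (um m x) (am m x) ∂μ : ℝ) :
        EReal)) atTop := by
  have norm_fst_le : ‖WithLp.fstL 2 ℝ E F‖ ≤ 1 :=
    ContinuousLinearMap.opNorm_le_bound _ zero_le_one fun w => by
      rw [one_mul]; exact WithLp.norm_fst_le _ w
  have norm_snd_le : ‖WithLp.sndL 2 ℝ E F‖ ≤ 1 :=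
    ContinuousLinearMap.opNorm_le_bound _ zero_le_one fun w => by
      rw [one_mul]; exact WithLp.norm_snd_le _ w
  have h := integral_coupledForm_comp_le_liminf norm_fst_le norm_snd_le hc hc₀ hκm hKm hκB hKκ hκ
    hK (hu.prodMk ha)
  simpa only [WithLp.fstL_apply, WithLp.sndL_apply, WithLp.toLp_fst, WithLp.toLp_snd] using h

end BlockOperator

section StressCoupling

variable {N : ℕ}

/-- The operator `A ↦ (A v) × d`, which represents the trilinear term: `(Aᵀ (d × u)) · v` is its
inner product with `u`. -/
def stressCoupling (d : Vec 3) (v : Vec N) : Mat3 N →L[ℝ] Vec 3 :=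
  LinearMap.toContinuousLinearMap <|
    (WithLp.linearEquiv 2 ℝ (Fin 3 → ℝ)).symm.toLinearMap ∘ₗ crossProduct.flip d.ofLp ∘ₗ
      (Matrix.mulVecBilin ℝ ℝ).flip v.ofLp ∘ₗ (Matrix.ofLinearEquiv ℝ).toLinearMap ∘ₗ
      (LinearEquiv.curry ℝ ℝ (Fin 3) (Fin N)).toLinearMap ∘ₗ
      (WithLp.linearEquiv 2 ℝ (Fin 3 × Fin N → ℝ)).toLinearMap

lemma stressCoupling_apply (d : Vec 3) (v : Vec N) (A : Mat3 N) :
    stressCoupling d v A =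
      WithLp.toLp 2 ((Matrix.of (fun i j => A (i, j)) *ᵥ v.ofLp) ⨯₃ d.ofLp) := rfl

lemma inner_stressCoupling (d u : Vec 3) (v : Vec N) (A : Mat3 N) :
    inner ℝ (stressCoupling d v A) u = transposeMulCross A d u ⬝ᵥ v.ofLp := by
  rw [EuclideanSpace.inner_eq_star_dotProduct, star_trivial, stressCoupling_apply,
    transposeMulCross, Matrix.mulVec_transpose, ← Matrix.dotProduct_mulVec,
    triple_product_permutation, dotProduct_comm]

lemma norm_mulVec_le (A : Mat3 N) (v : Vec N) :
    ‖(WithLp.toLp 2 (Matrix.of (fun i j => A (i, j)) *ᵥ v.ofLp) : Vec 3)‖ ≤ ‖A‖ * ‖v‖ := by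
  refine (abs_le_of_sq_le_sq' ?_ (by positivity)).2
  rw [mul_pow]
  simp only [EuclideanSpace.real_norm_sq_eq, Fintype.sum_prod_type]
  rw [Finset.sum_mul]
  exact Finset.sum_le_sum fun i _ =>
    Finset.sum_mul_sq_le_sq_mul_sq Finset.univ (fun j => A (i, j)) v.ofLp

lemma norm_toLp_crossProduct_le (a b : Vec 3) :
    ‖(WithLp.toLp 2 (a.ofLp ⨯₃ b.ofLp) : Vec 3)‖ ≤ ‖a‖ * ‖b‖ := by
  rw [InnerProductGeometry.norm_ofLp_crossProduct]
  exact mul_le_of_le_one_right (by positivity) (Real.sin_le_one _)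

lemma norm_stressCoupling_le (d : Vec 3) (v : Vec N) : ‖stressCoupling d v‖ ≤ ‖d‖ * ‖v‖ := by
  refine ContinuousLinearMap.opNorm_le_bound _ (by positivity) fun A => ?_
  rw [stressCoupling_apply]
  set a : Vec 3 := WithLp.toLp 2 (Matrix.of (fun i j => A (i, j)) *ᵥ v.ofLp)
  calc ‖(WithLp.toLp 2 (a.ofLp ⨯₃ d.ofLp) : Vec 3)‖
      ≤ ‖a‖ * ‖d‖ := norm_toLp_crossProduct_le a d
    _ ≤ ‖A‖ * ‖v‖ * ‖d‖ := by gcongr; exact norm_mulVec_le A v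
    _ = ‖d‖ * ‖v‖ * ‖A‖ := by ring

lemma continuous_crossProduct :
    Continuous fun p : (Fin 3 → ℝ) × (Fin 3 → ℝ) => p.1 ⨯₃ p.2 := by
  simp only [cross_apply]
  fun_prop

lemma continuous_stressCoupling :
    Continuous fun p : Vec 3 × Vec N => stressCoupling p.1 p.2 := by
  refine continuous_clm_apply.2 fun A => (PiLp.continuous_toLp 2 _).comp ?_
  exact continuous_crossProduct.comp
    (f := fun p : Vec 3 × Vec N => (Matrix.of (fun i j => A (i, j)) *ᵥ p.2.ofLp, p.1.ofLp))
    (by fun_prop)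

lemma memLp_top_stressCoupling {α : Type*} [MeasurableSpace α] {μ : Measure α} {d : α → Vec 3}
    {v : α → Vec N} (hd : MemLp d ∞ μ) (hv : MemLp v ∞ μ) :
    MemLp (fun x => stressCoupling (d x) (v x)) ∞ μ := by
  have hmeas := continuous_stressCoupling.comp_aestronglyMeasurable (hd.1.prodMk hv.1)
  have hbound : MemLp (fun x => ‖d x‖ * ‖v x‖) ∞ μ := hv.norm.mul' hd.norm
  exact hbound.mono' hmeas (.of_forall fun x => norm_stressCoupling_le (d x) (v x))

end StressCoupling

section Slices

variable {α β V : Type*} [MeasurableSpace α] [MeasurableSpace β] {μ : Measure α} {ν : Measure β}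
  [NormedAddCommGroup V]

lemma measurable_eLpNorm_top_slice [SFinite ν] {f : α × β → V} (hf : StronglyMeasurable f) :
    Measurable fun t => eLpNorm (fun x => f (t, x)) ∞ ν := by
  refine measurable_of_Iic fun a => ?_
  have sublevel_eq : (fun t => eLpNorm (fun x => f (t, x)) ∞ ν) ⁻¹' Set.Iic a
      = {t | ν (Prod.mk t ⁻¹' {z | a < ‖f z‖ₑ}) = 0} := by
    ext t
    have hset : Prod.mk t ⁻¹' {z | a < ‖f z‖ₑ} = {x | ¬ ‖f (t, x)‖ₑ ≤ a} := by
      ext x; simp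
    rw [Set.mem_preimage, Set.mem_Iic, Set.mem_ofPred_eq, hset, ← ae_iff, eLpNorm_exponent_top]
    exact ⟨fun h => ae_le_eLpNormEssSup.mono fun x hx => hx.trans h,
      eLpNormEssSup_le_of_ae_enorm_bound⟩
  rw [sublevel_eq]
  exact measurable_measure_prodMk_left (measurableSet_lt measurable_const hf.enorm)
    (measurableSet_singleton 0)

lemma aemeasurable_eLpNorm_top_slice [SFinite ν] {f : α × β → V}
    (hf : AEStronglyMeasurable f (μ.prod ν)) :
    AEMeasurable (fun t => eLpNorm (fun x => f (t, x)) ∞ ν) μ :=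
  ⟨_, measurable_eLpNorm_top_slice hf.stronglyMeasurable_mk,
    (Measure.ae_ae_of_ae_prod hf.ae_eq_mk).mono fun _ ht => eLpNorm_congr_ae ht⟩

lemma ae_eLpNorm_top_slice_le [SFinite ν] (f : α × β → V) :
    ∀ᵐ t ∂μ, eLpNorm (fun x => f (t, x)) ∞ ν ≤ eLpNorm f ∞ (μ.prod ν) := by
  simp only [eLpNorm_exponent_top]
  exact (Measure.ae_ae_of_ae_prod ae_le_eLpNormEssSup).mono fun t ht =>
    eLpNormEssSup_le_of_ae_enorm_bound ht

lemma ae_enorm_le_eLpNorm_top_slice [SFinite μ] [SFinite ν] {f : α × β → V}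
    (hf : AEStronglyMeasurable f (μ.prod ν)) :
    ∀ᵐ z ∂μ.prod ν, ‖f z‖ₑ ≤ eLpNorm (fun x => f (z.1, x)) ∞ ν := by
  have mk_le : ∀ᵐ z ∂μ.prod ν, ‖hf.mk f z‖ₑ ≤ eLpNorm (fun x => hf.mk f (z.1, x)) ∞ ν := by
    refine (Measure.ae_prod_iff_ae_ae (measurableSet_le hf.stronglyMeasurable_mk.enorm
      ((measurable_eLpNorm_top_slice hf.stronglyMeasurable_mk).comp measurable_fst))).2 ?_
    exact Eventually.of_forall fun t => by simpa using ae_le_eLpNormEssSup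
  have slice_eq : ∀ᵐ z ∂μ.prod ν, (fun x => f (z.1, x)) =ᵐ[ν] fun x => hf.mk f (z.1, x) :=
    Measure.quasiMeasurePreserving_fst.ae (Measure.ae_ae_of_ae_prod hf.ae_eq_mk)
  filter_upwards [mk_le, slice_eq, hf.ae_eq_mk] with z hle hslice hz
  rwa [hz, eLpNorm_congr_ae hslice]

lemma StrongLpTendsto.tendsto_toReal_eLpNorm {p : ℝ≥0∞} [Fact (1 ≤ p)] {f : ℕ → α → V}
    {f₀ : α → V} (hf : StrongLpTendsto p μ f f₀) :
    Tendsto (fun m => (eLpNorm (f m) p μ).toReal) atTop (𝓝 (eLpNorm f₀ p μ).toReal) := by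
  obtain ⟨hf, hf₀, hlim⟩ := hf
  simpa only [Lp.norm_toLp] using ((Lp.tendsto_Lp_iff_tendsto_eLpNorm'' f hf f₀ hf₀).2 hlim).norm

lemma StrongLpTendsto.ae_slice [SFinite ν] {f : ℕ → α × β → V} {f₀ : α × β → V}
    (hf : StrongLpTendsto ∞ (μ.prod ν) f f₀) :
    ∀ᵐ t ∂μ, StrongLpTendsto ∞ ν (fun m x => f m (t, x)) (fun x => f₀ (t, x)) := by
  obtain ⟨hf, hf₀, hlim⟩ := hf
  have slice_memLp {g : α × β → V} (hg : MemLp g ∞ (μ.prod ν)) :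
      ∀ᵐ t ∂μ, MemLp (fun x => g (t, x)) ∞ ν := by
    filter_upwards [hg.1.prodMk_left, ae_eLpNorm_top_slice_le (ν := ν) g] with t hmeas hle
      using ⟨hmeas, hle.trans_lt hg.2⟩
  filter_upwards [ae_all_iff.2 fun m => slice_memLp (hf m), slice_memLp hf₀,
    ae_all_iff.2 fun m => ae_eLpNorm_top_slice_le (ν := ν) (f m - f₀)] with t hft hf₀t hle
  exact ⟨hft, hf₀t, tendsto_of_tendsto_of_tendsto_of_le_of_le tendsto_const_nhds hlim
    (fun _ => zero_le) hle⟩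

end Slices

section Cylinder

variable {N : ℕ} {T : ℝ} {Ω : Set (Vec N)} {v : ℝ × Vec N → Vec N}

lemma ae_cylinder_fst {p : ℝ → Prop} (hp : ∀ᵐ t ∂volume.restrict (Set.Ioo 0 T), p t) :
    ∀ᵐ z ∂cylinder T Ω, p z.1 :=
  Measure.quasiMeasurePreserving_fst.ae hp

lemma memLp_top_cylinder_fst {φ : ℝ → ℝ} (hφ : MemLp φ ∞ (volume.restrict (Set.Ioo 0 T))) :
    MemLp (fun z => φ z.1) ∞ (cylinder T Ω) :=
  memLp_top_of_bound hφ.1.comp_fst (lpNorm φ ∞ _)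
    (ae_cylinder_fst (ae_le_lpNorm_exponent_top hφ))

lemma aestronglyMeasurable_regWeight (hv : AEStronglyMeasurable v (cylinder T Ω)) :
    AEStronglyMeasurable (fun z => regWeight Ω fun x => v (z.1, x)) (cylinder T Ω) :=
  AEStronglyMeasurable.comp_fst (f := fun t => regWeight Ω fun x => v (t, x))
    (((aemeasurable_eLpNorm_top_slice hv).ennreal_toReal.pow_const 2).const_mul
      (1 / 2)).aestronglyMeasurable

lemma ae_regWeight_le (hv : MemLp v ∞ (cylinder T Ω)) {R : ℝ}
    (hR : (eLpNorm v ∞ (cylinder T Ω)).toReal ≤ R) :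
    ∀ᵐ z ∂cylinder T Ω, regWeight Ω (fun x => v (z.1, x)) ≤ 1 / 2 * R ^ 2 := by
  filter_upwards [ae_cylinder_fst (ae_eLpNorm_top_slice_le (ν := volume.restrict Ω) v)] with z hz
  unfold regWeight
  gcongr
  exact (ENNReal.toReal_mono hv.2.ne hz).trans hR

lemma memLp_top_regWeight (hv : MemLp v ∞ (cylinder T Ω)) :
    MemLp (fun z => regWeight Ω fun x => v (z.1, x)) ∞ (cylinder T Ω) := by
  refine memLp_top_of_bound (aestronglyMeasurable_regWeight hv.1)
    (1 / 2 * (eLpNorm v ∞ (cylinder T Ω)).toReal ^ 2) ?_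
  filter_upwards [ae_regWeight_le hv le_rfl] with z hz
  rwa [Real.norm_of_nonneg (by unfold regWeight; positivity)]

lemma ae_norm_sq_le_two_mul_regWeight (hv : MemLp v ∞ (cylinder T Ω)) :
    ∀ᵐ z ∂cylinder T Ω, ‖v z‖ ^ 2 ≤ 2 * regWeight Ω (fun x => v (z.1, x)) := by
  filter_upwards [ae_enorm_le_eLpNorm_top_slice hv.1,
    ae_cylinder_fst (ae_eLpNorm_top_slice_le (ν := volume.restrict Ω) v)] with z hle hslice
  have norm_le : ‖v z‖ ≤ (eLpNorm (fun x => v (z.1, x)) ∞ (volume.restrict Ω)).toReal := by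
    rw [← toReal_enorm]
    exact ENNReal.toReal_mono (hslice.trans_lt hv.2).ne hle
  unfold regWeight
  linarith [pow_le_pow_left₀ (norm_nonneg _) norm_le 2]

lemma StrongLpTendsto.ae_tendsto_regWeight {vm : ℕ → ℝ × Vec N → Vec N}
    (hv : StrongLpTendsto ∞ (cylinder T Ω) vm v) :
    ∀ᵐ z ∂cylinder T Ω, Tendsto (fun m => regWeight Ω fun x => vm m (z.1, x)) atTop
      (𝓝 (regWeight Ω fun x => v (z.1, x))) :=
  ae_cylinder_fst (hv.ae_slice.mono fun _ ht => (ht.tendsto_toReal_eLpNorm.pow 2).const_mul (1 / 2))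

variable {φ : ℝ → ℝ} {d U : ℝ × Vec N → Vec 3} {G : ℝ × Vec N → Mat3 N}

/-- The space-time integrand of `stressDensity`. -/
def stressIntegrand (Ω : Set (Vec N)) (φ : ℝ → ℝ) (d U : ℝ × Vec N → Vec 3)
    (G : ℝ × Vec N → Mat3 N) (v : ℝ × Vec N → Vec N) (z : ℝ × Vec N) : ℝ :=
  φ z.1 * coupledForm (regWeight Ω fun x => v (z.1, x)) (stressCoupling (d z) (v z)) (U z) (G z)

lemma integrable_stressIntegrand (hφ : MemLp φ ∞ (volume.restrict (Set.Ioo 0 T)))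
    (hd : MemLp d ∞ (cylinder T Ω)) (hv : MemLp v ∞ (cylinder T Ω)) (hU : MemLp U 2 (cylinder T Ω))
    (hG : MemLp G 2 (cylinder T Ω)) : Integrable (stressIntegrand Ω φ d U G v) (cylinder T Ω) :=
  (integrable_coupledForm (memLp_top_regWeight hv) (memLp_top_stressCoupling hd hv) hU
    hG).mul_of_top_right (memLp_top_cylinder_fst hφ)

lemma ae_integral_stressIntegrand_eq_stressDensity
    (hd : MemLp d ∞ (cylinder T Ω)) (hv : MemLp v ∞ (cylinder T Ω)) (hU : MemLp U 2 (cylinder T Ω))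
    (hG : MemLp G 2 (cylinder T Ω)) :
    (fun t => ∫ x in Ω, stressIntegrand Ω φ d U G v (t, x)) =ᵐ[volume.restrict (Set.Ioo 0 T)]
      stressDensity Ω φ d U G v := by
  have hcoupling := integrable_inner_clm_apply (memLp_top_stressCoupling hd hv) hG hU
  filter_upwards [(hU.integrable_norm_pow two_ne_zero).prod_right_ae, hcoupling.prod_right_ae,
    (hG.integrable_norm_pow two_ne_zero).prod_right_ae] with t hUt hcouplingt hGt
  have hdiff : Integrable (fun x => ‖U (t, x)‖ ^ 2
      - inner ℝ (stressCoupling (d (t, x)) (v (t, x)) (G (t, x))) (U (t, x)))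
      (volume.restrict Ω) := hUt.sub hcouplingt
  simp only [stressIntegrand, coupledForm, stressDensity, stressFunctional, integral_const_mul]
  rw [integral_add hdiff ((hGt.const_mul _).const_mul _),
    integral_sub hUt hcouplingt, integral_const_mul, integral_const_mul]
  simp only [inner_stressCoupling]

lemma integrableOn_stressDensity (hφ : MemLp φ ∞ (volume.restrict (Set.Ioo 0 T)))
    (hd : MemLp d ∞ (cylinder T Ω)) (hv : MemLp v ∞ (cylinder T Ω)) (hU : MemLp U 2 (cylinder T Ω))
    (hG : MemLp G 2 (cylinder T Ω)) : IntegrableOn (stressDensity Ω φ d U G v) (Set.Ioo 0 T) :=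
  (integrable_stressIntegrand hφ hd hv hU hG).integral_prod_left.congr
    (ae_integral_stressIntegrand_eq_stressDensity hd hv hU hG)

lemma integral_stressDensity (hφ : MemLp φ ∞ (volume.restrict (Set.Ioo 0 T)))
    (hd : MemLp d ∞ (cylinder T Ω)) (hv : MemLp v ∞ (cylinder T Ω)) (hU : MemLp U 2 (cylinder T Ω))
    (hG : MemLp G 2 (cylinder T Ω)) :
    ∫ t in Set.Ioo 0 T, stressDensity Ω φ d U G v t =
      ∫ z, stressIntegrand Ω φ d U G v z ∂cylinder T Ω := by
  rw [← integral_congr_ae (ae_integral_stressIntegrand_eq_stressDensity hd hv hU hG), cylinder,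
    integral_prod _ (integrable_stressIntegrand hφ hd hv hU hG)]

variable {dm Um : ℕ → ℝ × Vec N → Vec 3} {Gm : ℕ → ℝ × Vec N → Mat3 N}
  {vm : ℕ → ℝ × Vec N → Vec N}

theorem integral_stressIntegrand_le_liminf (hφ : MemLp φ ∞ (volume.restrict (Set.Ioo 0 T)))
    (hφ₀ : ∀ᵐ t ∂volume.restrict (Set.Ioo 0 T), 0 ≤ φ t)
    (hdm : ∀ m, AEStronglyMeasurable (dm m) (cylinder T Ω))
    (hdm_le : ∀ m, ∀ᵐ z ∂cylinder T Ω, ‖dm m z‖ ≤ 1) (hd : TendstoAESubseq (cylinder T Ω) dm d)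
    (hG : WeakL2Tendsto (cylinder T Ω) Gm G) (hU : WeakL2Tendsto (cylinder T Ω) Um U)
    (hv : StrongLpTendsto ∞ (cylinder T Ω) vm v) :
    ((∫ z, stressIntegrand Ω φ d U G v z ∂cylinder T Ω : ℝ) : EReal) ≤
      liminf (fun m => ((∫ z, stressIntegrand Ω φ (dm m) (Um m) (Gm m) (vm m) z
        ∂cylinder T Ω : ℝ) : EReal)) atTop := by
  obtain ⟨R, hR⟩ := hv.tendsto_toReal_eLpNorm.bddAbove_range
  have hcouplingm (m : ℕ) :=
    continuous_stressCoupling.comp_aestronglyMeasurable ((hdm m).prodMk (hv.1 m).1)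
  have hcoupling : TendstoAESubseq (cylinder T Ω) (fun m z => stressCoupling (dm m z) (vm m z))
      fun z => stressCoupling (d z) (v z) :=
    (hd.prodMk (hv.tendstoAESubseq ENNReal.top_ne_zero)).continuous_comp fun _ =>
      continuous_stressCoupling
  have hcoupling_le (m : ℕ) : ∀ᵐ z ∂cylinder T Ω,
      ‖stressCoupling (dm m z) (vm m z)‖ ^ 2 ≤ 2 * regWeight Ω fun x => vm m (z.1, x) := by
    filter_upwards [hdm_le m, ae_norm_sq_le_two_mul_regWeight (hv.1 m)] with z hdz hvz
    refine (pow_le_pow_left₀ (norm_nonneg _) ?_ 2).trans hvz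
    exact (norm_stressCoupling_le _ _).trans (mul_le_of_le_one_left (norm_nonneg _) hdz)
  exact integral_coupledForm_le_liminf (memLp_top_cylinder_fst hφ) (ae_cylinder_fst hφ₀)
    (fun m => aestronglyMeasurable_regWeight (hv.1 m).1)
    hcouplingm (fun m => ae_regWeight_le (hv.1 m) (hR ⟨m, rfl⟩)) hcoupling_le
    (tendstoAESubseq_of_ae_tendsto hv.ae_tendsto_regWeight) hcoupling hU hG

end Cylinder

theorem lemma4p4_general {N : ℕ} {T : ℝ} {Ω : Set (Vec N)}
    (dm : ℕ → ℝ × Vec N → Vec 3) (d : ℝ × Vec N → Vec 3)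
    (Gm : ℕ → ℝ × Vec N → Mat3 N) (D : ℝ × Vec N → Mat3 N) (Um : ℕ → ℝ × Vec N → Vec 3)
    (U : ℝ × Vec N → Vec 3) (vm : ℕ → ℝ × Vec N → Vec N) (v : ℝ × Vec N → Vec N)
    (_hD : ∀ᵐ t ∂volume.restrict (Set.Ioo 0 T),
      HasWeakGradient Ω (fun x => d (t, x)) (fun x => D (t, x)))
    (hdm : ∀ m, AEStronglyMeasurable (dm m) (cylinder T Ω))
    (hd : TendstoInMeasure (cylinder T Ω) dm atTop d)
    (hG : WeakL2Tendsto (cylinder T Ω) Gm D) (hU : WeakL2Tendsto (cylinder T Ω) Um U)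
    (hv : StrongLpTendsto ∞ (cylinder T Ω) vm v)
    (hd_bound : ∀ m, eLpNorm (dm m) ∞ (cylinder T Ω) ≤ 1) (φ : ℝ → ℝ)
    (hφ : MemLp φ ∞ (volume.restrict (Set.Ioo 0 T)))
    (hφ₀ : ∀ᵐ t ∂volume.restrict (Set.Ioo 0 T), 0 ≤ φ t) :
    IntegrableOn (stressDensity Ω φ d U D v) (Set.Ioo 0 T) ∧
      (∀ m, IntegrableOn (stressDensity Ω φ (dm m) (Um m) (Gm m) (vm m)) (Set.Ioo 0 T)) ∧
      ((∫ t in Set.Ioo 0 T, stressDensity Ω φ d U D v t : ℝ) : EReal) ≤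
        liminf (fun m => ((∫ t in Set.Ioo 0 T,
          stressDensity Ω φ (dm m) (Um m) (Gm m) (vm m) t : ℝ) : EReal)) atTop := by
  have hlim := tendstoAESubseq_of_tendstoInMeasure hd
  have hdm_le (m : ℕ) : ∀ᵐ z ∂cylinder T Ω, ‖dm m z‖ ≤ 1 := by
    filter_upwards [ae_le_eLpNormEssSup (f := dm m)] with z hz
    rw [← ENNReal.ofReal_le_one, ofReal_norm]
    exact hz.trans (hd_bound m)
  have hd_top : MemLp d ∞ (cylinder T Ω) :=
    memLp_top_of_bound (hlim.aestronglyMeasurable hdm) 1 (hlim.ae_norm_le hdm_le)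
  have hdm_top (m : ℕ) : MemLp (dm m) ∞ (cylinder T Ω) :=
    ⟨hdm m, (hd_bound m).trans_lt ENNReal.one_lt_top⟩
  obtain ⟨hUm₂, hU₂, -⟩ := id hU
  obtain ⟨hGm₂, hG₂, -⟩ := id hG
  obtain ⟨hvm, hv_top, -⟩ := id hv
  refine ⟨integrableOn_stressDensity hφ hd_top hv_top hU₂ hG₂,
    fun m => integrableOn_stressDensity hφ (hdm_top m) (hvm m) (hUm₂ m) (hGm₂ m), ?_⟩
  simp only [integral_stressDensity hφ hd_top hv_top hU₂ hG₂,
    fun m => integral_stressDensity hφ (hdm_top m) (hvm m) (hUm₂ m) (hGm₂ m)]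
  exact integral_stressIntegrand_le_liminf hφ hφ₀ hdm hdm_le hlim hG hU hv

end EricksenStress

end

theorem lemma4p4 (N : ℕ) (hN : N = 2 ∨ N = 3) (Ω : Set (EricksenStress.Vec N))
    (hΩ : EricksenStress.IsConvexPolyhedralDomain Ω) (T : ℝ) (hT : 0 < T)
    -- the sequences and their limits; `D` is the weak spatial gradient of `d`
    (dm : ℕ → ℝ × EricksenStress.Vec N → EricksenStress.Vec 3)
    (d : ℝ × EricksenStress.Vec N → EricksenStress.Vec 3)
    (Gm : ℕ → ℝ × EricksenStress.Vec N → EricksenStress.Mat3 N)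
    (D : ℝ × EricksenStress.Vec N → EricksenStress.Mat3 N)
    (Um : ℕ → ℝ × EricksenStress.Vec N → EricksenStress.Vec 3)
    (U : ℝ × EricksenStress.Vec N → EricksenStress.Vec 3)
    (vm : ℕ → ℝ × EricksenStress.Vec N → EricksenStress.Vec N)
    (v : ℝ × EricksenStress.Vec N → EricksenStress.Vec N)
    (hD : ∀ᵐ t ∂(volume.restrict (Set.Ioo 0 T)),
      EricksenStress.HasWeakGradient Ω (fun x => d (t, x)) (fun x => D (t, x)))
    -- the convergences
    (hd : ∀ p : ℝ≥0∞, 1 ≤ p → p ≠ ⊤ →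
      EricksenStress.StrongLpTendsto p (EricksenStress.cylinder T Ω) dm d)
    (hG : EricksenStress.WeakL2Tendsto (EricksenStress.cylinder T Ω) Gm D)
    (hU : EricksenStress.WeakL2Tendsto (EricksenStress.cylinder T Ω) Um U)
    (hv : EricksenStress.StrongLpTendsto ∞ (EricksenStress.cylinder T Ω) vm v)
    -- the uniform bounds
    (hd_bound : ∀ m, eLpNorm (dm m) ∞ (EricksenStress.cylinder T Ω) ≤ 1)
    (C : ℝ) (hC : 0 < C)
    (hv_bound : ∀ m, ∀ᵐ t ∂(volume.restrict (Set.Ioo 0 T)),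
      EricksenStress.H2NormLE Ω (fun x => vm m (t, x)) C) :
    ∀ φ : ℝ → ℝ, MemLp φ ∞ (volume.restrict (Set.Ioo 0 T)) →
      (∀ᵐ t ∂(volume.restrict (Set.Ioo 0 T)), 0 ≤ φ t) →
      IntegrableOn (EricksenStress.stressDensity Ω φ d U D v) (Set.Ioo 0 T) ∧
      (∀ m, IntegrableOn
        (EricksenStress.stressDensity Ω φ (dm m) (Um m) (Gm m) (vm m)) (Set.Ioo 0 T)) ∧
      ((∫ t in Set.Ioo 0 T, EricksenStress.stressDensity Ω φ d U D v t : ℝ) : EReal) ≤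
        liminf (fun m => ((∫ t in Set.Ioo 0 T,
          EricksenStress.stressDensity Ω φ (dm m) (Um m) (Gm m) (vm m) t : ℝ) : EReal)) atTop := by
  obtain ⟨hdm, hd, hlim⟩ := hd 2 one_le_two ENNReal.ofNat_ne_top
  exact EricksenStress.lemma4p4_general dm d Gm D Um U vm v hD (fun m => (hdm m).1)
    (tendstoInMeasure_of_tendsto_eLpNorm two_ne_zero (fun m => (hdm m).1) hd.1 hlim) hG hU hv
    hd_bound
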